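/- Let $k\in\{1,2\}$, $a>0$, $c>0$ and $\sigma\le\mu<0$, and put $M_0=-\frac ac$ and $N_0=\frac{a\sigma}{c\mu}$. For real $x,y,v$ let $$D(x,y)=(|\mu|+|\sigma|)\bigl[1+(|\mu|+|\sigma|)\max(|x|,|y|)\,c\bigr]\max(|x|,|y|),$$ and for $\theta\le 0$ let $$H_{(1)}(v,x,y)(\theta)=\begin{cases}x,&\theta<0,\\ -\frac{\mu}{\sigma}v,&\theta=0,\end{cases}\qquad H_{(2)}(v,x,y)(\theta)=\begin{cases}x,&\theta\le \operatorname{sign}(y-x)\frac{x+\mu v/\sigma}{D(x,y)},\\ -\frac{\mu}{\sigma}v+\operatorname{sign}(y-x)D(x,y)\,\theta,&\theta> \operatorname{sign}(y-x)\frac{x+\mu v/\sigma}{D(x,y)},\end{cases}$$ where $\operatorname{sign}(0)=0$ and the threshold in $H_{(2)}$ is read as $0$ when $x=y=0$. Define $$\mathcal Q_{(k)}(v,x,y)=v+\frac{\mu}{\sigma}v e^{\mu(a+cv)}-\sigma\int_{-a-cv}^{0}e^{-\mu\theta}H_{(k)}(v,x,y)(\theta)\,d\theta .$$ Suppose that the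 only pair $(M,N)\in[M_0,0]\times[0,N_0]$ with $\mathcal Q_{(k)}(N,M,N)=\mathcal Q_{(k)}(M,N,M)=0$ is $M=N=0$. Let $\varphi:(-\infty,0]\to\mathbb R$ be a history function and put $\tau=a+c\max\{N_0,\varphi(0)\}$. Suppose that $\varphi$ is continuous on $[-\tau,0]$ and that $\varphi(t)\ge M_0$ for all $t\in[-\tau,0]$. Then every solution $u$ of $$\dot u(t)=\mu u(t)+\sigma u\bigl(t-a-cu(t)\bigr)\quad(t\ge 0),\qquad u(t)=\varphi(t)\quad(t\le 0),$$ where $\dot u(0)$ denotes the right derivative, satisfies $u(t)\to 0$ as $t\to\infty$. -/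

import Mathlib

namespace Sawtooth

noncomputable section

/-- The lower constant `M₀ = -a/c`. -/
def M0 (a c : ℝ) : ℝ := -(a / c)

/-- The upper constant `N₀ = aσ/(cμ)`. -/
def N0 (a c μ σ : ℝ) : ℝ := a * σ / (c * μ)

/-- The a priori bound `τ = a + cN` on the delay, where `N = max {N₀, φ(0)}`. -/
def tau (a c μ σ : ℝ) (φ : ℝ → ℝ) : ℝ := a + c * max (N0 a c μ σ) (φ 0)

/-- `u` solves `u'(t) = μ u(t) + σ u(t - a - c u(t))` for all `t ≥ 0` with history `u = φ` on
`(-∞, 0]`. The derivative is taken in `[0, ∞)`: it is the ordinary derivative for `t > 0` and the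
right derivative at `t = 0`. -/
structure IsSolution (a c μ σ : ℝ) (φ u : ℝ → ℝ) : Prop where
  history : ∀ t ≤ 0, u t = φ t
  equation : ∀ t ≥ 0,
    HasDerivWithinAt u (μ * u t + σ * u (t - a - c * u t)) (Set.Ici 0) t

/-- `D(x,y) = (|μ|+|σ|) [1 + (|μ|+|σ|) max(|x|,|y|) c] max(|x|,|y|)`. -/
def D (c μ σ x y : ℝ) : ℝ :=
  (|μ| + |σ|) * (1 + (|μ| + |σ|) * max |x| |y| * c) * max |x| |y|

/-- `H₍₁₎(v,x,y)(θ)`, for `θ ≤ 0`; it does not depend on `y`. -/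
def H1 (μ σ v x θ : ℝ) : ℝ :=
  if θ < 0 then x else -(μ / σ) * v

/-- `H₍₂₎(v,x,y)(θ)`, for `θ ≤ 0`. Here `Real.sign 0 = 0`. For `x = y = 0`, where `D(x,y) = 0`,
the threshold is read as `0`. -/
def H2 (c μ σ v x y θ : ℝ) : ℝ :=
  if θ ≤ Real.sign (y - x) * ((x + μ * v / σ) / D c μ σ x y) then x
  else -(μ / σ) * v + Real.sign (y - x) * D c μ σ x y * θ

/-- `H₍ₖ₎(v,x,y)(θ)`; only `k = 1` and `k = 2` are meant. -/
def H (k : ℕ) (c μ σ v x y θ : ℝ) : ℝ :=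
  if k = 1 then H1 μ σ v x θ else H2 c μ σ v x y θ

/-- `Q₍ₖ₎(v,x,y) = v + (μ/σ) v e^{μ(a+cv)} - σ ∫_{-a-cv}^0 e^{-μθ} H₍ₖ₎(v,x,y)(θ) dθ`. -/
def Q (k : ℕ) (a c μ σ v x y : ℝ) : ℝ :=
  v + μ / σ * v * Real.exp (μ * (a + c * v))
    - σ * ∫ θ in (-a - c * v)..0, Real.exp (-μ * θ) * H k c μ σ v x y θ

end

end Sawtooth

/-!
The solution stays between the barriers `M0` and `N0 + C e^{μ t}` (`IsSolution.M0_le`,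
`IsSolution.le_N0_add`), so `L = liminf u` and `S = limsup u` satisfy `M0 ≤ L` and `S ≤ N0`. Also
`L ≤ 0 ≤ S`, because a solution that stays below a negative constant increases at a rate bounded
away from zero (`nonneg_of_eventually_le`).

If `L < S`, there are late local maxima with value close to `S`. At such a time `t` the equation
gives `u (t - a - c u t) = -(μ/σ) u t`, and the delayed values before `t` are bounded below by `L`
up to a small error, and are Lipschitz with a constant close to `D(L, S)`. Integrating the equation
over one delay and passing to the limit yields `Q(S, L, S) ≤ 0` (`Phi_nonpos_of_limits`). The
argument allows either sign of `c`, hence applies to `-u`, which solves the equation with `-c`, and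
yields `Q(L, S, L) ≥ 0`.

It remains to go from these inequalities to equalities. On the rectangle `[M0, 0] × [0, N0]` the
functional `Q(N, M, N)` does not increase when `M` decreases, and is positive for `N = N0`, while
`Q(M, N, M)` does not decrease when `N` increases, and is negative for `M = M0`. Hence a longest
interval `[M, N]` containing `[L, S]` for which `Q(N, M, N) ≤ 0 ≤ Q(M, N, M)` has both values equal to zero
(`exists_common_zero`), so it is degenerate by hypothesis, and `L = S = 0`.
-/

/-! ### The extremal functionals -/

namespace Sawtooth

open Set Filter Topology

/-- The lower bound at `s = t + θ`, `θ ≤ 0`, for the delayed values `u (s - a - c u s)` preceding a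
local maximum `v = u t`: for `k = 1` only the lower bound `x` of `u` is used, otherwise also that
these values are `d`-Lipschitz and equal `-(μ/σ) v` at `θ = 0`. -/
noncomputable def lowerEnv (k : ℕ) (μ σ v x d θ : ℝ) : ℝ :=
  if k = 1 then x else max x (-(μ / σ) * v + d * θ)

/-- The functional `Q` with `H` replaced by the lower envelope, the Lipschitz constant `d` being a
free parameter. The sign of `c` is arbitrary, so that the functional also describes local minima,
by passing from `(u, c)` to `(-u, -c)`. -/
noncomputable def Phi (k : ℕ) (a c μ σ v x d : ℝ) : ℝ :=
  v + μ / σ * v * Real.exp (μ * (a + c * v))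
    - σ * ∫ θ in (-a - c * v)..0, Real.exp (-μ * θ) * lowerEnv k μ σ v x d θ

section

variable {k : ℕ} {a c μ σ v x y d d' θ : ℝ}

lemma continuous_lowerEnv {X : Type*} [TopologicalSpace X] {v x d θ : X → ℝ} (hv : Continuous v)
    (hx : Continuous x) (hd : Continuous d) (hθ : Continuous θ) :
    Continuous fun p => lowerEnv k μ σ (v p) (x p) (d p) (θ p) := by
  unfold lowerEnv
  split_ifs
  · exact hx
  · fun_prop

lemma le_lowerEnv : x ≤ lowerEnv k μ σ v x d θ := by
  unfold lowerEnv
  split_ifs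
  · exact le_rfl
  · exact le_max_left _ _

lemma lowerEnv_mono (hxy : x ≤ y) (hd : d' ≤ d) (hθ : θ ≤ 0) :
    lowerEnv k μ σ v x d θ ≤ lowerEnv k μ σ v y d' θ := by
  unfold lowerEnv
  split_ifs
  · exact hxy
  · exact max_le_max hxy (by nlinarith)

lemma continuous_Phi {X : Type*} [TopologicalSpace X] {v x d : X → ℝ} (hv : Continuous v)
    (hx : Continuous x) (hd : Continuous d) :
    Continuous fun p => Phi k a c μ σ (v p) (x p) (d p) := by
  unfold Phi
  have h : Continuous fun p =>
      ∫ θ in (0 : ℝ)..(-a - c * v p), Real.exp (-μ * θ) * lowerEnv k μ σ (v p) (x p) (d p) θ := by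
    apply intervalIntegral.continuous_parametric_intervalIntegral_of_continuous
    · have := continuous_lowerEnv (k := k) (μ := μ) (σ := σ) (hv.comp continuous_fst)
        (hx.comp continuous_fst) (hd.comp continuous_fst)
        (continuous_snd : Continuous (Prod.snd : X × ℝ → ℝ))
      simp only [Function.comp_def] at this
      simp only [Function.uncurry_def]
      fun_prop
    · fun_prop
  simp only [intervalIntegral.integral_symm (0 : ℝ)] at *
  fun_prop

lemma intervalIntegrable_lowerEnv {p q : ℝ} :
    IntervalIntegrable (fun θ => Real.exp (-μ * θ) * lowerEnv k μ σ v x d θ)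
      MeasureTheory.volume p q := by
  have := continuous_lowerEnv (k := k) (μ := μ) (σ := σ) (continuous_const (y := v))
    (continuous_const (y := x)) (continuous_const (y := d)) continuous_id
  simp only [id] at this
  exact (by fun_prop : Continuous _).intervalIntegrable _ _

lemma Phi_mono (hσ : σ < 0) (hT : 0 ≤ a + c * v) (hxy : x ≤ y) (hd : d' ≤ d) :
    Phi k a c μ σ v x d ≤ Phi k a c μ σ v y d' := by
  unfold Phi
  have : ∫ θ in (-a - c * v)..0, Real.exp (-μ * θ) * lowerEnv k μ σ v x d θ ≤
      ∫ θ in (-a - c * v)..0, Real.exp (-μ * θ) * lowerEnv k μ σ v y d' θ := by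
    refine intervalIntegral.integral_mono_on (by linarith) intervalIntegrable_lowerEnv
      intervalIntegrable_lowerEnv fun θ hθ => ?_
    exact mul_le_mul_of_nonneg_left (lowerEnv_mono hxy hd hθ.2) (Real.exp_pos _).le
  nlinarith

lemma Phi_pos_of_delay_eq_zero (hσ : σ < 0) (hμ : μ < 0) (hv : 0 < v) (hT : a + c * v = 0) :
    0 < Phi k a c μ σ v x d := by
  have h0 : -a - c * v = 0 := by linarith
  have h1 : 0 < μ / σ := div_pos_of_neg_of_neg hμ hσ
  simp only [Phi, h0, hT, intervalIntegral.integral_same]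
  have := mul_pos h1 hv
  simp
  linarith

lemma integral_exp_neg_mul (hμ : μ ≠ 0) (T : ℝ) :
    ∫ θ in (-T)..0, Real.exp (-μ * θ) = (Real.exp (μ * T) - 1) / μ := by
  rw [intervalIntegral.integral_eq_sub_of_hasDerivAt (f := fun θ => -(Real.exp (-μ * θ) / μ))]
  · simp
    ring
  · intro θ _
    have h : HasDerivAt (fun θ => -μ * θ) (-μ) θ := by
      simpa using (hasDerivAt_id θ).const_mul (-μ)
    convert! (h.exp.div_const μ).neg using 1
    field_simp
  · exact (by fun_prop : Continuous _).intervalIntegrable _ _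

lemma Phi_pos_of_le (hσ : σ < 0) (hμ : μ < 0) (hv : 0 < v) (hT : 0 ≤ a + c * v)
    (hx : -(μ / σ) * v ≤ x) : 0 < Phi k a c μ σ v x d := by
  have h1 : ∫ θ in (-(a + c * v))..0, Real.exp (-μ * θ) * x ≤
      ∫ θ in (-(a + c * v))..0, Real.exp (-μ * θ) * lowerEnv k μ σ v x d θ := by
    refine intervalIntegral.integral_mono_on (by linarith)
      ((by fun_prop : Continuous _).intervalIntegrable _ _) intervalIntegrable_lowerEnv
      fun θ _ => ?_
    exact mul_le_mul_of_nonneg_left le_lowerEnv (Real.exp_pos _).le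
  rw [intervalIntegral.integral_mul_const, integral_exp_neg_mul hμ.ne] at h1
  unfold Phi
  rw [show -a - c * v = -(a + c * v) by ring]
  set I := ∫ θ in (-(a + c * v))..0, Real.exp (-μ * θ) * lowerEnv k μ σ v x d θ
  set E := Real.exp (μ * (a + c * v))
  have hE : 0 < E := Real.exp_pos _
  have hE1 : E ≤ 1 := Real.exp_le_one_iff.2 (by nlinarith)
  have hr : 0 < μ / σ := div_pos_of_neg_of_neg hμ hσ
  have h2 : (E - 1) / μ * (-(μ / σ) * v) ≤ I :=
    (mul_le_mul_of_nonneg_left hx (div_nonneg_of_nonpos (by linarith) hμ.le)).trans h1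
  have h3 : -σ * ((E - 1) / μ * (-(μ / σ) * v)) = (E - 1) * v := by
    field_simp [hσ.ne, hμ.ne]
  have h4 := mul_le_mul_of_nonneg_left h2 (by linarith : 0 ≤ -σ)
  have h5 : 0 < μ / σ * v * E := by positivity
  have h6 : 0 < v * E := by positivity
  linarith

lemma D_comm : D c μ σ x y = D c μ σ y x := by
  simp only [D, max_comm]

lemma D_neg_neg : D c μ σ (-x) (-y) = D c μ σ x y := by
  simp only [D, abs_neg]

lemma D_mono {x' y' : ℝ} (hc : 0 ≤ c) (hx : |x| ≤ |x'|) (hy : |y| ≤ |y'|) :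
    D c μ σ x y ≤ D c μ σ x' y' := by
  unfold D
  have h := max_le_max hx hy
  have h0 : 0 ≤ max |x| |y| := (abs_nonneg x).trans (le_max_left _ _)
  gcongr

lemma continuous_D {X : Type*} [TopologicalSpace X] {x y : X → ℝ} (hx : Continuous x)
    (hy : Continuous y) : Continuous fun p => D c μ σ (x p) (y p) := by
  unfold D
  fun_prop

lemma D_pos (hc : 0 < c) (hμ : μ < 0) (hxy : x ≠ y) : 0 < D c μ σ x y := by
  have hm : 0 < max |x| |y| := by
    rw [lt_max_iff, abs_pos, abs_pos]
    by_contra! h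
    exact hxy (h.1.trans h.2.symm)
  have h1 : 0 < |μ| := abs_pos.2 hμ.ne
  unfold D
  positivity

/-- The threshold in `H2` is the point where the ramp meets the level `M`, so `H2` is the maximum of
both; a nonnegative threshold means that the ramp stays below `M` for `θ < 0`. -/
lemma H_eq_lowerEnv {M N : ℝ} (hc : 0 < c) (hμ : μ < 0) (hM : M ≤ 0) (hN : 0 ≤ N) (hθ : θ < 0) :
    H k c μ σ N M N θ = lowerEnv k μ σ N M (D c μ σ M N) θ := by
  unfold H H1 H2 lowerEnv
  by_cases hk : k = 1
  · simp [hk, hθ]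
  simp only [hk, if_false]
  rcases eq_or_ne M N with h | h
  · obtain rfl : M = 0 := by linarith
    obtain rfl : N = 0 := h.symm
    simp [D, hθ.le]
  have hD := D_pos (σ := σ) hc hμ h
  have hMN : 0 < N - M := lt_of_le_of_ne (by linarith) (by intro h'; apply h; linarith)
  simp only [Real.sign_of_pos hMN, one_mul, le_div_iff₀ hD]
  have he : μ * N / σ = μ / σ * N := by ring
  split_ifs with h1
  · rw [max_eq_left]
    linarith
  · rw [max_eq_right]
    linarith

lemma H_eq_neg_lowerEnv {M N : ℝ} (hc : 0 < c) (hμ : μ < 0) (hM : M ≤ 0) (hN : 0 ≤ N)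
    (hθ : θ < 0) :
    H k c μ σ M N M θ = -lowerEnv k μ σ (-M) (-N) (D c μ σ M N) θ := by
  unfold H H1 H2 lowerEnv
  by_cases hk : k = 1
  · simp [hk, hθ]
  simp only [hk, if_false]
  rcases eq_or_ne M N with h | h
  · obtain rfl : M = 0 := by linarith
    obtain rfl : N = 0 := h.symm
    simp [D, hθ.le]
  have hD := D_pos (σ := σ) hc hμ h
  have hMN : M - N < 0 := lt_of_le_of_ne (by linarith) (by intro h'; apply h; linarith)
  simp only [Real.sign_of_neg hMN, D_comm (x := N), neg_one_mul, ← neg_div, le_div_iff₀ hD]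
  have he : -μ / σ * -M = μ * M / σ := by ring
  rw [he]
  split_ifs with h1
  · rw [max_eq_left] <;> linarith
  · rw [max_eq_right]
    · ring
    · linarith

lemma Q_eq_Phi {M N : ℝ} (hc : 0 < c) (hμ : μ < 0) (hM : M ≤ 0) (hN : 0 ≤ N)
    (hT : 0 ≤ a + c * N) :
    Q k a c μ σ N M N = Phi k a c μ σ N M (D c μ σ M N) := by
  unfold Q Phi
  rw [intervalIntegral.integral_congr_Ioo_of_le (by linarith)]
  intro θ hθ
  simp only [H_eq_lowerEnv hc hμ hM hN hθ.2]

lemma Q_eq_neg_Phi {M N : ℝ} (hc : 0 < c) (hμ : μ < 0) (hM : M ≤ 0) (hN : 0 ≤ N)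
    (hT : 0 ≤ a + c * M) :
    Q k a c μ σ M N M = -Phi k a (-c) μ σ (-M) (-N) (D c μ σ M N) := by
  unfold Q Phi
  rw [intervalIntegral.integral_congr_Ioo_of_le
    (g := fun θ => -(Real.exp (-μ * θ) * lowerEnv k μ σ (-M) (-N) (D c μ σ M N) θ)) (by linarith),
    intervalIntegral.integral_neg, neg_mul_neg]
  · ring
  · intro θ hθ
    simp only [H_eq_neg_lowerEnv hc hμ hM hN hθ.2, mul_neg]

end

/-! ### Enlarging a rectangle up to a common zero -/

/-- If `F` and `G` are nonpositive at `(x₀, y₀)`, then, among the points of the rectangle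
`[x₀, P] × [y₀, R]` with this property, one that maximises `x + y` is a common zero: where `F` is
negative, increasing `x` keeps `F` negative and does not increase `G`. -/
lemma exists_common_zero {F G : ℝ → ℝ → ℝ} {x₀ y₀ P R : ℝ} (hx₀ : x₀ ≤ P) (hy₀ : y₀ ≤ R)
    (hF : Continuous (Function.uncurry F)) (hG : Continuous (Function.uncurry G))
    (hFy : ∀ x ∈ Icc x₀ P, AntitoneOn (F x) (Icc y₀ R))
    (hGx : ∀ y ∈ Icc y₀ R, AntitoneOn (fun x => G x y) (Icc x₀ P))
    (hFP : ∀ y ∈ Icc y₀ R, 0 < F P y) (hGR : ∀ x ∈ Icc x₀ P, 0 < G x R)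
    (hF₀ : F x₀ y₀ ≤ 0) (hG₀ : G x₀ y₀ ≤ 0) :
    ∃ x ∈ Icc x₀ P, ∃ y ∈ Icc y₀ R, F x y = 0 ∧ G x y = 0 := by
  let A : Set (ℝ × ℝ) :=
    (Icc x₀ P ×ˢ Icc y₀ R) ∩ ({p | F p.1 p.2 ≤ 0} ∩ {p | G p.1 p.2 ≤ 0})
  have hA : IsCompact A := (isCompact_Icc.prod isCompact_Icc).inter_right
    ((isClosed_le hF continuous_const).inter (isClosed_le hG continuous_const))
  have hne : A.Nonempty :=
    ⟨(x₀, y₀), ⟨⟨le_rfl, hx₀⟩, ⟨le_rfl, hy₀⟩⟩, hF₀, hG₀⟩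
  obtain ⟨⟨x, y⟩, ⟨⟨hx, hy⟩, hFxy, hGxy⟩, hmax⟩ :=
    hA.exists_isMaxOn hne (f := fun p => p.1 + p.2) (by fun_prop)
  change x ∈ Icc x₀ P at hx
  change y ∈ Icc y₀ R at hy
  change F x y ≤ 0 at hFxy
  change G x y ≤ 0 at hGxy
  refine ⟨x, hx, y, hy, le_antisymm hFxy (not_lt.1 fun hlt => ?_),
    le_antisymm hGxy (not_lt.1 fun hlt => ?_)⟩
  · have hxP : x < P := lt_of_le_of_ne hx.2 (by rintro rfl; linarith [hFP y hy])
    have hc : Continuous fun x => F x y := hF.comp (continuous_id.prodMk continuous_const)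
    have hev : ∀ᶠ x' in 𝓝[>] x, F x' y < 0 :=
      nhdsWithin_le_nhds (hc.continuousAt.eventually_lt continuousAt_const hlt)
    obtain ⟨x', hx', hxx'⟩ := (hev.and (Ioc_mem_nhdsGT hxP)).exists
    have hx'' : x' ∈ Icc x₀ P := ⟨hx.1.trans hxx'.1.le, hxx'.2⟩
    have : x' + y ≤ x + y := hmax (a := (x', y)) ⟨⟨hx'', hy⟩, hx'.le, (hGx y hy hx hx'' hxx'.1.le).trans hGxy⟩
    linarith [hxx'.1]
  · have hyR : y < R := lt_of_le_of_ne hy.2 (by rintro rfl; linarith [hGR x hx])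
    have hc : Continuous fun y => G x y := hG.comp (continuous_const.prodMk continuous_id)
    have hev : ∀ᶠ y' in 𝓝[>] y, G x y' < 0 :=
      nhdsWithin_le_nhds (hc.continuousAt.eventually_lt continuousAt_const hlt)
    obtain ⟨y', hy', hyy'⟩ := (hev.and (Ioc_mem_nhdsGT hyR)).exists
    have hy'' : y' ∈ Icc y₀ R := ⟨hy.1.trans hyy'.1.le, hyy'.2⟩
    have : x + y' ≤ x + y := hmax (a := (x, y')) ⟨⟨hx, hy''⟩, (hFy x hx hy hy'' hyy'.1.le).trans hFxy, hy'.le⟩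
    linarith [hyy'.1]

/-- If the only common zero of the two functionals in the admissible rectangle is the origin, then
the origin is the only point satisfying the two extremal inequalities. -/
lemma eq_zero_of_Phi_nonpos {k : ℕ} {a c μ σ M N : ℝ} (ha : 0 < a) (hc : 0 < c) (hσ : σ < 0)
    (hμ : μ < 0)
    (hQ : ∀ M ∈ Icc (M0 a c) 0, ∀ N ∈ Icc 0 (N0 a c μ σ),
      Q k a c μ σ N M N = 0 → Q k a c μ σ M N M = 0 → M = 0 ∧ N = 0)
    (hM : M ∈ Icc (M0 a c) 0) (hN : N ∈ Icc 0 (N0 a c μ σ))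
    (h1 : Phi k a c μ σ N M (D c μ σ M N) ≤ 0)
    (h2 : Phi k a (-c) μ σ (-M) (-N) (D c μ σ M N) ≤ 0) : M = 0 ∧ N = 0 := by
  have hM0 : M0 a c < 0 := neg_neg_of_pos (div_pos ha hc)
  have hr : 0 < μ / σ := div_pos_of_neg_of_neg hμ hσ
  have hN0 : 0 < N0 a c μ σ := div_pos_of_neg_of_neg (by nlinarith) (by nlinarith)
  have hcM0 : a + c * M0 a c = 0 := by unfold M0; field_simp; ring
  have hN0M0 : -(μ / σ) * N0 a c μ σ = M0 a c := by
    unfold M0 N0; field_simp [hσ.ne, hμ.ne]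
  have hT1 : ∀ {x}, 0 ≤ x → 0 ≤ a + c * x := fun hx => by positivity
  have hT2 : ∀ {m}, m ≤ -M0 a c → 0 ≤ a + -c * m := fun hm => by nlinarith
  obtain ⟨x, hx, y, hy, hFxy, hGxy⟩ := exists_common_zero (x₀ := N) (y₀ := -M)
    (P := N0 a c μ σ) (R := -M0 a c)
    (F := fun x y => Phi k a c μ σ x (-y) (D c μ σ (-y) x))
    (G := fun x y => Phi k a (-c) μ σ y (-x) (D c μ σ (-y) x)) hN.2 (by linarith [hM.1])
    (continuous_Phi continuous_fst continuous_snd.neg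
      (continuous_D continuous_snd.neg continuous_fst))
    (continuous_Phi continuous_snd continuous_fst.neg
      (continuous_D continuous_snd.neg continuous_fst))
    (fun x hx y hy y' hy' hyy' => Phi_mono hσ (hT1 (hN.1.trans hx.1)) (by linarith)
      (D_mono hc.le (by
        rw [abs_neg, abs_neg]
        exact abs_le_abs_of_nonneg (by linarith [hy.1, hM.2]) hyy') le_rfl))
    (fun y hy x hx x' hx' hxx' => Phi_mono hσ (hT2 hy.2) (by linarith)
      (D_mono hc.le le_rfl (abs_le_abs_of_nonneg (hN.1.trans hx.1) hxx')))
    (fun y hy => Phi_pos_of_le hσ hμ hN0 (hT1 hN0.le) (by linarith [hy.2]))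
    (fun x hx => Phi_pos_of_delay_eq_zero hσ hμ (by linarith) (by linarith))
    (by simpa using h1) (by simpa using h2)
  have hy0 : -y ≤ 0 := by linarith [hy.1, hM.2]
  have hx0 : 0 ≤ x := hN.1.trans hx.1
  have := hQ (-y) ⟨by linarith [hy.2], hy0⟩ x ⟨hx0, hx.2⟩
    ((Q_eq_Phi hc hμ hy0 hx0 (hT1 hx0)).trans hFxy)
    ((Q_eq_neg_Phi hc hμ hy0 hx0 (by linarith [hT2 hy.2])).trans
      (by simpa using hGxy))
  constructor
  · linarith [hM.2, hy.1]
  · linarith [hN.1, hx.1]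

/-! ### The equation near large local maxima -/

section

variable {k : ℕ} {a c μ σ τ x y t L S : ℝ} {u : ℝ → ℝ}

/-- At a critical point `t` of `u` the functional `Phi` is nonpositive. The delayed values
`u (s - a - c u s)` are Lipschitz in `s ≤ t` with constant `D` and equal `-(μ/σ) u t` at `s = t`,
so they lie above the lower envelope; integrating the equation over one delay then gives the
inequality. -/
lemma Phi_nonpos_of_critical (hσ : σ < 0)
    (hd : ∀ s > 0, HasDerivAt u (μ * u s + σ * u (s - a - c * u s)) s)
    (hτ : ∀ s > 0, 0 ≤ a + c * u s ∧ a + c * u s ≤ τ) (ht : 3 * τ < t)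
    (hu : ∀ s ≥ t - 3 * τ, x ≤ u s ∧ u s ≤ y)
    (hcrit : μ * u t + σ * u (t - a - c * u t) = 0) :
    Phi k a c μ σ (u t) x (D |c| μ σ x y) ≤ 0 := by
  have hτ0 : 0 ≤ τ := (hτ 1 one_pos).1.trans (hτ 1 one_pos).2
  set m := max |x| |y| with hm
  set C := (|μ| + |σ|) * m with hC
  have hm0 : 0 ≤ m := (abs_nonneg x).trans (le_max_left _ _)
  have hC0 : 0 ≤ C := by positivity
  have hum : ∀ s ≥ t - 3 * τ, |u s| ≤ m := fun s hs => abs_le_max_abs_abs (hu s hs).1 (hu s hs).2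
  have hD : D |c| μ σ x y = C * (1 + |c| * C) := by
    simp only [D, ← hm, hC]
    ring
  have hlip : ∀ p ∈ Ici (t - 2 * τ), ∀ q ∈ Ici (t - 2 * τ), |u q - u p| ≤ C * |q - p| := by
    intro p hp q hq
    refine (convex_Ici (t - 2 * τ)).norm_image_sub_le_of_norm_hasDerivWithin_le
      (fun s hs => (hd s ?_).hasDerivWithinAt) (fun s hs => ?_) hp hq
    · linarith [mem_Ici.1 hs]
    · have hs' : t - 2 * τ ≤ s := hs
      have h1 := hum s (by linarith)
      have h2 := hum (s - a - c * u s) (by linarith [(hτ s (by linarith)).2])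
      calc ‖μ * u s + σ * u (s - a - c * u s)‖
          ≤ |μ * u s| + |σ * u (s - a - c * u s)| := abs_add_le _ _
        _ ≤ |μ| * m + |σ| * m := by
          rw [abs_mul, abs_mul]
          gcongr
        _ = C := by rw [hC]; ring
  have htpos : 0 < t := by linarith
  set T := a + c * u t with hT
  have hT0 : 0 ≤ T := (hτ t htpos).1
  have hTτ : T ≤ τ := (hτ t htpos).2
  have hcrit' : u (t - a - c * u t) = -(μ / σ) * u t := by
    field_simp [hσ.ne]
    linarith
  have henv : ∀ θ ∈ Icc (-T) 0, lowerEnv k μ σ (u t) x (D |c| μ σ x y) θ ≤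
      u (t + θ - a - c * u (t + θ)) := by
    intro θ hθ
    have hpos : 0 < t + θ := by linarith [hθ.1]
    have hα : t - 2 * τ ≤ t + θ - a - c * u (t + θ) := by
      linarith [hθ.1, (hτ _ hpos).2]
    have hx : x ≤ u (t + θ - a - c * u (t + θ)) := (hu _ (by linarith)).1
    unfold lowerEnv
    split_ifs
    · exact hx
    refine max_le hx ?_
    have h1 := hlip (t + θ - a - c * u (t + θ)) hα (t - a - c * u t)
      (mem_Ici.2 (by linarith))
    have h2 := hlip (t + θ) (mem_Ici.2 (by linarith [hθ.1])) t (mem_Ici.2 (by linarith))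
    have h3 : |t - a - c * u t - (t + θ - a - c * u (t + θ))| ≤ (1 + |c| * C) * -θ := by
      calc |t - a - c * u t - (t + θ - a - c * u (t + θ))|
          = |-θ - c * (u t - u (t + θ))| := by ring_nf
        _ ≤ |-θ| + |c * (u t - u (t + θ))| := abs_sub _ _
        _ ≤ -θ + |c| * (C * -θ) := by
          rw [abs_mul, abs_of_nonneg (by linarith [hθ.2] : 0 ≤ -θ)]
          gcongr
          rwa [show t - (t + θ) = -θ by ring, abs_of_nonneg (by linarith [hθ.2] : 0 ≤ -θ)] at h2
        _ = (1 + |c| * C) * -θ := by ring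
    have h4 := (le_abs_self _).trans (h1.trans (mul_le_mul_of_nonneg_left h3 hC0))
    rw [hcrit'] at h4
    rw [hD]
    linarith
  have hcont : ∀ s > 0, ContinuousAt u s := fun s hs => (hd s hs).continuousAt
  have hint : IntervalIntegrable
      (fun θ => Real.exp (-μ * θ) * (σ * u (t + θ - a - c * u (t + θ))))
      MeasureTheory.volume (-T) 0 := by
    apply ContinuousOn.intervalIntegrable_of_Icc (by linarith)
    intro θ hθ
    have hpos : 0 < t + θ := by linarith [hθ.1]
    have h1 : ContinuousAt (fun θ => u (t + θ)) θ :=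
      ContinuousAt.comp (g := u) (hcont _ hpos) (by fun_prop)
    have h2 : ContinuousAt (fun θ => u (t + θ - a - c * u (t + θ))) θ :=
      ContinuousAt.comp (g := u) (hcont _ (by linarith [hθ.1, (hτ _ hpos).2])) (by fun_prop)
    have h3 : ContinuousAt (fun θ => Real.exp (-μ * θ)) θ := by fun_prop
    exact (h3.mul (h2.const_mul σ)).continuousWithinAt
  have hFTC : ∫ θ in (-T)..0, Real.exp (-μ * θ) * (σ * u (t + θ - a - c * u (t + θ))) =
      u t - Real.exp (μ * T) * u (t - T) := by
    rw [intervalIntegral.integral_eq_sub_of_hasDerivAt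
      (f := fun θ => Real.exp (-μ * θ) * u (t + θ)) _ hint]
    · simp [sub_eq_add_neg]
    · intro θ hθ
      rw [uIcc_of_le (by linarith)] at hθ
      have h1 : HasDerivAt (fun θ => -μ * θ) (-μ) θ := by
        simpa using (hasDerivAt_id θ).const_mul (-μ)
      have h2 := (hd (t + θ) (by linarith [hθ.1])).comp_const_add t θ
      convert! h1.exp.mul h2 using 1
      ring
  have hmono : ∫ θ in (-T)..0, Real.exp (-μ * θ) * (σ * u (t + θ - a - c * u (t + θ))) ≤
      ∫ θ in (-T)..0, σ * (Real.exp (-μ * θ) *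
        lowerEnv k μ σ (u t) x (D |c| μ σ x y) θ) := by
    refine intervalIntegral.integral_mono_on (by linarith) hint
      (intervalIntegrable_lowerEnv.const_mul σ) fun θ hθ => ?_
    have := mul_le_mul_of_nonneg_left (henv θ hθ) (Real.exp_pos (-μ * θ)).le
    nlinarith
  rw [intervalIntegral.integral_const_mul, hFTC,
    show t - T = t - a - c * u t by rw [hT]; ring, hcrit'] at hmono
  unfold Phi
  rw [show -a - c * u t = -T by rw [hT]; ring]
  linarith

/-- A solution that returns infinitely often both near `S` and near some `L < S` has local maxima
near `S` at arbitrarily late times. -/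
lemma exists_critical_of_frequently (hLS : L < S)
    (hd : ∀ s > 0, HasDerivAt u (μ * u s + σ * u (s - a - c * u s)) s)
    (hS : ∀ ε > 0, ∃ᶠ s in atTop, S - ε < u s) (hL : ∀ ε > 0, ∃ᶠ s in atTop, u s < L + ε)
    {ε : ℝ} (hε : 0 < ε) (t₀ : ℝ) :
    ∃ t > t₀, S - ε < u t ∧ μ * u t + σ * u (t - a - c * u t) = 0 := by
  set δ := min ε ((S - L) / 2)
  have hδ : 0 < δ := lt_min hε (by linarith)
  have hδε : δ ≤ ε := min_le_left _ _
  have hδ' : L + (S - L) / 2 ≤ S - δ := by linarith [min_le_right ε ((S - L) / 2)]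
  obtain ⟨t₁, ht₁, hu₁⟩ := frequently_atTop.1 (hL ((S - L) / 2) (by linarith)) (max t₀ 0 + 1)
  obtain ⟨t₂, ht₂, hu₂⟩ := frequently_atTop.1 (hS δ hδ) t₁
  obtain ⟨t₃, ht₃, hu₃⟩ := frequently_atTop.1 (hL ((S - L) / 2) (by linarith)) t₂
  have ht₁0 : 0 < t₁ := by linarith [le_max_right t₀ 0]
  have hcont : ContinuousOn u (Icc t₁ t₃) := fun s hs =>
    (hd s (by linarith [hs.1])).continuousAt.continuousWithinAt
  obtain ⟨t, ht, hmax⟩ := isCompact_Icc.exists_isMaxOn ⟨t₂, ht₂, ht₃⟩ hcont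
  have hut : u t₂ ≤ u t := hmax ⟨ht₂, ht₃⟩
  have h1 : t₁ < t := lt_of_le_of_ne ht.1 (by rintro rfl; linarith)
  have h3 : t < t₃ := lt_of_le_of_ne ht.2 (by rintro rfl; linarith)
  refine ⟨t, by linarith [le_max_left t₀ 0], by linarith, ?_⟩
  exact (hmax.isLocalMax (Icc_mem_nhds h1 h3)).hasDerivAt_eq_zero (hd t (by linarith))

/-- The extremal inequality at the limit superior `S` of a solution with limit inferior `L`. -/
lemma Phi_nonpos_of_limits (hσ : σ < 0) (hLS : L < S)
    (hd : ∀ s > 0, HasDerivAt u (μ * u s + σ * u (s - a - c * u s)) s)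
    (hτ : ∀ s > 0, 0 ≤ a + c * u s ∧ a + c * u s ≤ τ)
    (hS : ∀ ε > 0, ∃ᶠ s in atTop, S - ε < u s) (hL : ∀ ε > 0, ∃ᶠ s in atTop, u s < L + ε)
    (hS' : ∀ ε > 0, ∀ᶠ s in atTop, u s ≤ S + ε) (hL' : ∀ ε > 0, ∀ᶠ s in atTop, L - ε ≤ u s) :
    Phi k a c μ σ S L (D |c| μ σ L S) ≤ 0 := by
  have key : ∀ ε > 0, ∃ v, |v - S| ≤ ε ∧
      Phi k a c μ σ v (L - ε) (D |c| μ σ (L - ε) (S + ε)) ≤ 0 := by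
    intro ε hε
    obtain ⟨T, hT⟩ := eventually_atTop.1 ((hL' ε hε).and (hS' ε hε))
    obtain ⟨t, ht, hut, hcrit⟩ :=
      exists_critical_of_frequently hLS hd hS hL hε (max T 0 + 3 * τ)
    have hτ0 : 0 ≤ τ := (hτ 1 one_pos).1.trans (hτ 1 one_pos).2
    have hT' := le_max_left T 0
    have h0 := le_max_right T 0
    have htT : u t ≤ S + ε := (hT t (by linarith)).2
    refine ⟨u t, abs_le.2 ⟨by linarith, by linarith⟩, ?_⟩
    exact Phi_nonpos_of_critical hσ hd hτ (by linarith)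
      (fun s hs => hT s (by linarith)) hcrit
  choose! v hv hPhi using key
  have hε : Tendsto (fun ε : ℝ => ε) (𝓝[>] 0) (𝓝 0) := nhdsWithin_le_nhds
  have hvS : Tendsto v (𝓝[>] 0) (𝓝 S) := by
    rw [tendsto_iff_norm_sub_tendsto_zero]
    refine squeeze_zero' (Eventually.of_forall fun _ => norm_nonneg _) ?_ hε
    filter_upwards [self_mem_nhdsWithin] with ε hε using hv ε hε
  have hc : Continuous fun p : ℝ × ℝ =>
      Phi k a c μ σ p.1 (L - p.2) (D |c| μ σ (L - p.2) (S + p.2)) :=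
    continuous_Phi continuous_fst (by fun_prop) (continuous_D (by fun_prop) (by fun_prop))
  have hlim := (hc.tendsto (S, 0)).comp (hvS.prodMk_nhds hε)
  simp only [sub_zero, add_zero] at hlim
  refine le_of_tendsto hlim ?_
  filter_upwards [self_mem_nhdsWithin] with ε hε using hPhi ε hε

/-- A solution cannot stay below a negative constant, for it would then increase at a rate bounded
away from zero. -/
lemma nonneg_of_eventually_le (hσ : σ < 0) (hμ : μ < 0)
    (hd : ∀ s > 0, HasDerivAt u (μ * u s + σ * u (s - a - c * u s)) s)
    (hτ : ∀ s > 0, 0 ≤ a + c * u s ∧ a + c * u s ≤ τ)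
    (hS' : ∀ ε > 0, ∀ᶠ s in atTop, u s ≤ S + ε) : 0 ≤ S := by
  by_contra! hS
  obtain ⟨T, hT⟩ := eventually_atTop.1 (hS' (-S / 2) (by linarith))
  have hτ0 : 0 ≤ τ := (hτ 1 one_pos).1.trans (hτ 1 one_pos).2
  set t₀ := max T 0 + 1 + τ with ht₀
  have hT' := le_max_left T 0
  have h0 := le_max_right T 0
  set δ := (μ + σ) * (S / 2) with hδ
  have hδ0 : 0 < δ := mul_pos_of_neg_of_neg (by linarith) (by linarith)
  have hgrow : ∀ t ≥ t₀, δ * (t - t₀) ≤ u t - u t₀ := by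
    intro t ht
    refine (convex_Ici t₀).mul_sub_le_image_sub_of_le_deriv
      (fun s hs => (hd s ?_).continuousAt.continuousWithinAt)
      (fun s hs => (hd s ?_).differentiableAt.differentiableWithinAt) (fun s hs => ?_)
      t₀ self_mem_Ici t ht ht
    · linarith [mem_Ici.1 hs]
    · rw [interior_Ici] at hs
      linarith [mem_Ioi.1 hs]
    · rw [interior_Ici] at hs
      have hs : t₀ < s := hs
      rw [(hd s (by linarith)).deriv]
      have h1 := hT s (by linarith)
      have h2 := hT (s - a - c * u s) (by linarith [(hτ s (by linarith)).2])
      nlinarith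
  have hlarge : t₀ ≤ t₀ + |u t₀| / δ := by linarith [div_nonneg (abs_nonneg (u t₀)) hδ0.le]
  have h1 := hgrow _ hlarge
  have h2 := hT (t₀ + |u t₀| / δ) (by linarith)
  rw [add_sub_cancel_left, mul_div_cancel₀ _ hδ0.ne'] at h1
  linarith [neg_abs_le (u t₀)]

end

/-! ### A priori bounds -/

section

variable {a c μ σ : ℝ} {φ u : ℝ → ℝ}

lemma N0_pos (ha : 0 < a) (hc : 0 < c) (hσ : σ < 0) (hμ : μ < 0) : 0 < N0 a c μ σ :=
  div_pos_of_neg_of_neg (mul_neg_of_pos_of_neg ha hσ) (mul_neg_of_pos_of_neg hc hμ)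

lemma tau_pos (ha : 0 < a) (hc : 0 < c) (hσ : σ < 0) (hμ : μ < 0) : 0 < tau a c μ σ φ := by
  have := (N0_pos ha hc hσ hμ).trans_le (le_max_left _ (φ 0))
  unfold tau
  positivity

lemma IsSolution.hasDerivAt (hu : IsSolution a c μ σ φ u) {t : ℝ} (ht : 0 < t) :
    HasDerivAt u (μ * u t + σ * u (t - a - c * u t)) t :=
  (hu.equation t ht.le).hasDerivAt (Ici_mem_nhds ht)

lemma IsSolution.continuousOn (hu : IsSolution a c μ σ φ u) : ContinuousOn u (Ici 0) :=
  fun t ht => (hu.equation t ht).continuousWithinAt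

lemma IsSolution.hasDerivWithinAt_Ici (hu : IsSolution a c μ σ φ u) {t : ℝ} (ht : 0 ≤ t) :
    HasDerivWithinAt u (μ * u t + σ * u (t - a - c * u t)) (Ici t) t :=
  (hu.equation t ht).mono (Ici_subset_Ici.2 ht)

/-- The level `M0` is a lower barrier: there the delay vanishes and the derivative
`(μ + σ) M0` is positive. -/
lemma IsSolution.M0_le (hu : IsSolution a c μ σ φ u) (ha : 0 < a) (hc : 0 < c) (hσ : σ < 0)
    (hμ : μ < 0) (hφ : ∀ t ∈ Icc (-tau a c μ σ φ) 0, M0 a c ≤ φ t) {t : ℝ}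
    (ht : -tau a c μ σ φ ≤ t) : M0 a c ≤ u t := by
  have hτ := tau_pos (φ := φ) ha hc hσ hμ
  rcases le_total t 0 with h | h
  · rw [hu.history t h]
    exact hφ t ⟨ht, h⟩
  have hM0 : M0 a c < 0 := neg_neg_of_pos (div_pos ha hc)
  have hcM0 : a + c * M0 a c = 0 := by unfold M0; field_simp; ring
  have := image_le_of_deriv_right_lt_deriv_boundary (f := fun s => -u s)
    (f' := fun s => -(μ * u s + σ * u (s - a - c * u s))) (a := 0) (b := t)
    (B := fun _ => -M0 a c) (B' := fun _ => 0)
    (hu.continuousOn.neg.mono Icc_subset_Ici_self)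
    (fun s hs => (hu.hasDerivWithinAt_Ici hs.1).neg)
    (by rw [hu.history 0 le_rfl]; linarith [hφ 0 ⟨by linarith, le_rfl⟩])
    (fun _ => hasDerivAt_const _ _)
    (fun s _ hs => by
      have hs : u s = M0 a c := by linarith
      rw [show s - a - c * u s = s by rw [hs]; linarith, hs]
      nlinarith)
    ⟨h, le_rfl⟩
  linarith

/-- Since the delayed values are at least `M0`, a solution lies below the solution of
`w' = μ (w - N0)` starting at `max N0 (φ 0)`. -/
lemma IsSolution.le_N0_add (hu : IsSolution a c μ σ φ u) (ha : 0 < a) (hc : 0 < c) (hσ : σ < 0)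
    (hμ : μ < 0) (hφ : ∀ t ∈ Icc (-tau a c μ σ φ) 0, M0 a c ≤ φ t) {t : ℝ} (ht : 0 ≤ t) :
    u t ≤ N0 a c μ σ + (max (N0 a c μ σ) (φ 0) - N0 a c μ σ) * Real.exp (μ * t) := by
  set A := max (N0 a c μ σ) (φ 0) - N0 a c μ σ with hA
  have hA0 : 0 ≤ A := sub_nonneg.2 (le_max_left _ _)
  have hN0M0 : σ * M0 a c = -μ * N0 a c μ σ := by
    unfold M0 N0; field_simp [hσ.ne, hμ.ne]
  -- The slope `ε` makes the barrier strict; `ε ≤ 1 / c` keeps the delayed time above `-τ`.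
  have key : ∀ ε > 0, ε ≤ 1 / c → u t ≤ N0 a c μ σ + A * Real.exp (μ * t) + ε * t := by
    intro ε hε hεc
    rw [le_div_iff₀ hc] at hεc
    refine image_le_of_deriv_right_lt_deriv_boundary (a := 0) (b := t) (f := u)
      (f' := fun s => μ * u s + σ * u (s - a - c * u s))
      (B := fun s => N0 a c μ σ + A * Real.exp (μ * s) + ε * s)
      (B' := fun s => A * (Real.exp (μ * s) * μ) + ε)
      (hu.continuousOn.mono Icc_subset_Ici_self) (fun s hs => hu.hasDerivWithinAt_Ici hs.1)
      ?_ (fun s => ?_) (fun s hs hus => ?_) ⟨ht, le_rfl⟩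
    · rw [hu.history 0 le_rfl]
      simp [hA]
    · have h1 : HasDerivAt (fun s => μ * s) μ s := by
        simpa using (hasDerivAt_id s).const_mul μ
      have h2 : HasDerivAt (fun s => ε * s) ε s := by
        simpa using (hasDerivAt_id s).const_mul ε
      exact ((h1.exp.const_mul A).const_add _).add h2
    · have hs0 : 0 ≤ s := hs.1
      have hexp : Real.exp (μ * s) ≤ 1 := Real.exp_le_one_iff.2 (by nlinarith)
      have h1 : A * Real.exp (μ * s) ≤ A := mul_le_of_le_one_right hA0 hexp
      have h2 : -tau a c μ σ φ ≤ s - a - c * u s := by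
        have h3 : u s ≤ max (N0 a c μ σ) (φ 0) + ε * s := by linarith
        have h4 : c * u s ≤ c * (max (N0 a c μ σ) (φ 0) + ε * s) := by gcongr
        have h5 : ε * c * s ≤ 1 * s := by gcongr
        unfold tau
        linarith
      have h3 := mul_le_mul_of_nonpos_left (hu.M0_le ha hc hσ hμ hφ h2) hσ.le
      have h4 : μ * (ε * s) ≤ 0 := mul_nonpos_of_nonpos_of_nonneg hμ.le (by positivity)
      calc μ * u s + σ * u (s - a - c * u s)
          ≤ μ * u s + σ * M0 a c := by linarith
        _ = A * (Real.exp (μ * s) * μ) + μ * (ε * s) := by rw [hN0M0, hus]; ring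
        _ < A * (Real.exp (μ * s) * μ) + ε := by linarith
  have hlim : Tendsto (fun ε => N0 a c μ σ + A * Real.exp (μ * t) + ε * t) (𝓝[>] 0)
      (𝓝 (N0 a c μ σ + A * Real.exp (μ * t))) := by
    have : Continuous fun ε => N0 a c μ σ + A * Real.exp (μ * t) + ε * t := by fun_prop
    simpa using (this.tendsto 0).mono_left nhdsWithin_le_nhds
  refine ge_of_tendsto hlim ?_
  filter_upwards [Ioc_mem_nhdsGT (one_div_pos.2 hc)] with ε hε using key ε hε.1 hε.2

end

end Sawtooth

/-! ### Convergence to zero -/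

open Filter Topology in
theorem mainTheorem2 (k : ℕ) (hk : k = 1 ∨ k = 2) (a c μ σ : ℝ)
    (ha : 0 < a) (hc : 0 < c) (hσμ : σ ≤ μ) (hμ : μ < 0)
    (hQ : ∀ M ∈ Set.Icc (Sawtooth.M0 a c) 0, ∀ N ∈ Set.Icc 0 (Sawtooth.N0 a c μ σ),
      Sawtooth.Q k a c μ σ N M N = 0 → Sawtooth.Q k a c μ σ M N M = 0 → M = 0 ∧ N = 0)
    (φ : ℝ → ℝ)
    (hφ_cont : ContinuousOn φ (Set.Icc (-Sawtooth.tau a c μ σ φ) 0))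
    (hφ_lower : ∀ t ∈ Set.Icc (-Sawtooth.tau a c μ σ φ) 0, Sawtooth.M0 a c ≤ φ t)
    (u : ℝ → ℝ) (hu : Sawtooth.IsSolution a c μ σ φ u) :
    Filter.Tendsto u Filter.atTop (nhds 0) := by
  have hσ : σ < 0 := hσμ.trans_lt hμ
  have hτ0 := Sawtooth.tau_pos (φ := φ) ha hc hσ hμ
  set N := max (Sawtooth.N0 a c μ σ) (φ 0) with hN
  have hA0 : 0 ≤ N - Sawtooth.N0 a c μ σ := sub_nonneg.2 (le_max_left _ _)
  have hcM0 : a + c * Sawtooth.M0 a c = 0 := by unfold Sawtooth.M0; field_simp; ring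
  have hlow : ∀ t > 0, Sawtooth.M0 a c ≤ u t := fun t ht =>
    hu.M0_le ha hc hσ hμ hφ_lower (by linarith)
  have hup : ∀ t > 0, u t ≤ Sawtooth.N0 a c μ σ + (N - Sawtooth.N0 a c μ σ) * Real.exp (μ * t) :=
    fun t ht => hu.le_N0_add ha hc hσ hμ hφ_lower ht.le
  have hupN : ∀ t > 0, u t ≤ N := fun t ht => by
    have h1 := mul_le_of_le_one_right hA0
      (Real.exp_le_one_iff.2 (mul_nonpos_of_nonpos_of_nonneg hμ.le ht.le))
    linarith [hup t ht]
  have hd : ∀ s > 0, HasDerivAt u (μ * u s + σ * u (s - a - c * u s)) s :=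
    fun s hs => hu.hasDerivAt hs
  have hτ : ∀ s > 0, 0 ≤ a + c * u s ∧ a + c * u s ≤ Sawtooth.tau a c μ σ φ := by
    intro s hs
    have h1 := mul_le_mul_of_nonneg_left (hlow s hs) hc.le
    have h2 := mul_le_mul_of_nonneg_left (hupN s hs) hc.le
    unfold Sawtooth.tau
    exact ⟨by linarith, by linarith⟩
  -- The reflected function `-u` solves the equation in which `c` is replaced by `-c`.
  have hd_neg : ∀ s > 0, HasDerivAt (fun t => -u t)
      (μ * -u s + σ * -u (s - a - -c * -u s)) s := by
    intro s hs
    convert! (hd s hs).neg using 1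
    rw [neg_mul_neg]
    ring
  have hτ_neg : ∀ s > 0, 0 ≤ a + -c * -u s ∧ a + -c * -u s ≤ Sawtooth.tau a c μ σ φ := by
    intro s hs
    rw [neg_mul_neg]
    exact hτ s hs
  have hpos : ∀ᶠ t : ℝ in atTop, 0 < t := eventually_gt_atTop 0
  have hbdd : IsBoundedUnder (· ≤ ·) atTop u := ⟨N, eventually_map.2 (hpos.mono hupN)⟩
  have hbdd' : IsBoundedUnder (· ≥ ·) atTop u :=
    ⟨Sawtooth.M0 a c, eventually_map.2 (hpos.mono hlow)⟩
  set S := limsup u atTop with hS_def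
  set L := liminf u atTop with hL_def
  have hS' : ∀ ε > 0, ∀ᶠ s in atTop, u s ≤ S + ε := fun ε hε =>
    (eventually_lt_of_limsup_lt (by linarith : limsup u atTop < S + ε) hbdd).mono fun _ h => h.le
  have hL' : ∀ ε > 0, ∀ᶠ s in atTop, L - ε ≤ u s := fun ε hε =>
    (eventually_lt_of_lt_liminf (by linarith : L - ε < liminf u atTop) hbdd').mono fun _ h => h.le
  have hS : ∀ ε > 0, ∃ᶠ s in atTop, S - ε < u s := fun ε hε =>
    frequently_lt_of_lt_limsup hbdd'.isCoboundedUnder_le (by linarith)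
  have hL : ∀ ε > 0, ∃ᶠ s in atTop, u s < L + ε := fun ε hε =>
    frequently_lt_of_liminf_lt hbdd.isCoboundedUnder_ge (by linarith)
  have hS_neg : ∀ ε > 0, ∀ᶠ s in atTop, -u s ≤ -L + ε := fun ε hε =>
    (hL' ε hε).mono fun _ h => by linarith
  have hS0 : 0 ≤ S := Sawtooth.nonneg_of_eventually_le hσ hμ hd hτ hS'
  have hL0 : L ≤ 0 :=
    neg_nonneg.1 (Sawtooth.nonneg_of_eventually_le hσ hμ hd_neg hτ_neg hS_neg)
  have hLM0 : Sawtooth.M0 a c ≤ L :=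
    le_liminf_of_le hbdd.isCoboundedUnder_ge (hpos.mono hlow)
  have hSN0 : S ≤ Sawtooth.N0 a c μ σ := by
    have hexp : Tendsto (fun t => Real.exp (μ * t)) atTop (𝓝 0) :=
      Real.tendsto_exp_atBot.comp (tendsto_id.const_mul_atTop_of_neg hμ)
    have hlim := (hexp.const_mul (N - Sawtooth.N0 a c μ σ)).const_add (Sawtooth.N0 a c μ σ)
    rw [mul_zero, add_zero] at hlim
    rw [← hlim.limsup_eq]
    exact limsup_le_limsup (hpos.mono hup) hbdd'.isCoboundedUnder_le hlim.isBoundedUnder_le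
  have hzero : L = 0 ∧ S = 0 := by
    rcases hL0.trans hS0 |>.eq_or_lt with h | h
    · exact ⟨by linarith, by linarith⟩
    have h1 := Sawtooth.Phi_nonpos_of_limits (k := k) hσ h hd hτ hS hL hS' hL'
    have h2 := Sawtooth.Phi_nonpos_of_limits (k := k) hσ (neg_lt_neg h) hd_neg hτ_neg
      (fun ε hε => (hL ε hε).mono fun _ h => by linarith)
      (fun ε hε => (hS ε hε).mono fun _ h => by linarith) hS_neg
      (fun ε hε => (hS' ε hε).mono fun _ h => by linarith)
    rw [abs_neg, Sawtooth.D_neg_neg, Sawtooth.D_comm] at h2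
    rw [abs_of_pos hc] at h1 h2
    exact Sawtooth.eq_zero_of_Phi_nonpos ha hc hσ hμ hQ ⟨hLM0, hL0⟩ ⟨hS0, hSN0⟩ h1 h2
  exact tendsto_of_liminf_eq_limsup hzero.1 hzero.2 hbdd hbdd'
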